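/- Let $P$ be a partial order $\le_P$ on $\{1,\dots,n\}$. A $P$-partition is a map $f:\{1,\dots,n\}\to\mathbb{N}=\{0,1,2,\dots\}$ such that $f(i)\ge f(j)$ whenever $i<_P j$, and $f(i)>f(j)$ whenever $i<_P j$ and $i>j$. Let $F_P(\mathbf{x})=\sum_f x_1^{f(1)}\cdots x_n^{f(n)}$, summed over all $P$-partitions $f$. An order ideal of $P$ is a subset $J$ such that $i\in J$ and $j\le_P i$ imply $j\in J$; it is connected if it is nonempty and its Hasse diagram is a connected graph, and principal if it has the form $\{j : j\le_P i\}$. Write $\mathbf{x}^J=\prod_{i\in J}x_i$, and let $\mathcal{J}_{conn}(P)$ be the set of connected order ideals of $P$. Two order ideals $J_a,J_b$ intersect nontrivially if $J_a\cap J_b\ne\emptyset$, $J_a\not\subseteq J_b$ and $J_b\not\subseteq J_a$. Let $\Pi(P)$ be the set of unordered pairs $\{J_a,J_b\}$ of connected order ideals that intersect nontrivially, and let $G_P$ be the graph with vertex set $\mathcal{J}_{conn}(P)$ and edge set $\Pi(P)$. Suppose that $P$ is naturally labeled ($i<_P j$ implies $i<j$) and is a forest with duplications (every connected order ideal intersects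 at most one other connected order ideal nontrivially). Then, as formal power series in $x_1,\dots,x_n$, $$F_P(\mathbf{x})=\frac{\prod_{\{J_a,J_b\}\in\Pi(P)}\left(1-\mathbf{x}^{J_a}\mathbf{x}^{J_b}\right)}{\prod_{J\in\mathcal{J}_{conn}(P)}\left(1-\mathbf{x}^{J}\right)}.$$ Moreover, every connected component of $G_P$ has at most two vertices, and if a component has exactly two vertices, then both are principal order ideals of $P$. -/

import Mathlib

/-! Posets `P` on the ground set `{1, …, n}` are partial orders `P : PartialOrder (Fin n)`.  The
relations `P.le`, `P.lt` are those of the poset, while `≤`, `<` on `Fin n` always denote the natural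
order of the labels. -/

namespace PosetGF

variable {n : ℕ}

/-- `P` is naturally labeled: `i < j` whenever `i <_P j`. -/
def NaturallyLabeled (P : PartialOrder (Fin n)) : Prop :=
  ∀ i j : Fin n, P.lt i j → i < j

/-- `P`-partitions. -/
def IsPPartition (P : PartialOrder (Fin n)) (f : Fin n → ℕ) : Prop :=
  (∀ i j : Fin n, P.lt i j → f j ≤ f i) ∧
  (∀ i j : Fin n, P.lt i j → j < i → f j < f i)

open Classical in
/-- The fundamental generating function `F_P(x) = ∑ x^f` over all `P`-partitions `f`, as a formal
power series: the coefficient of `x^m` is `1` if `m` is a `P`-partition and `0` otherwise. -/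
noncomputable def genFun (P : PartialOrder (Fin n)) : MvPowerSeries (Fin n) ℚ :=
  fun m => if IsPPartition P m then 1 else 0

/-- Order ideals. -/
def IsOrderIdeal (P : PartialOrder (Fin n)) (J : Finset (Fin n)) : Prop :=
  ∀ i ∈ J, ∀ j : Fin n, P.le j i → j ∈ J

/-- The Hasse diagram of the subposet of `P` with ground set `J`. -/
def hasseDiagram (P : PartialOrder (Fin n)) (J : Finset (Fin n)) : SimpleGraph {i // i ∈ J} :=
  @SimpleGraph.hasse {i // i ∈ J} (@Subtype.preorder (Fin n) P.toPreorder (fun i => i ∈ J))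

/-- Connected order ideals (`SimpleGraph.Connected` includes that `J` is nonempty). -/
def IsConnIdeal (P : PartialOrder (Fin n)) (J : Finset (Fin n)) : Prop :=
  IsOrderIdeal P J ∧ (hasseDiagram P J).Connected

/-- The ideal is principal, i.e. of the form `{j | j ≤_P i}`. -/
def IsPrincipalIdeal (P : PartialOrder (Fin n)) (J : Finset (Fin n)) : Prop :=
  ∃ i : Fin n, ∀ j : Fin n, j ∈ J ↔ P.le j i

/-- `I` and `J` intersect nontrivially: they meet and neither contains the other. -/
def IntersectNontrivially (I J : Finset (Fin n)) : Prop :=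
  (I ∩ J).Nonempty ∧ ¬ I ⊆ J ∧ ¬ J ⊆ I

/-- `P` is a forest with duplications: every connected order ideal intersects at most one other
connected order ideal nontrivially. -/
def IsForestWithDuplications (P : PartialOrder (Fin n)) : Prop :=
  ∀ I : Finset (Fin n), IsConnIdeal P I →
    {J : Finset (Fin n) | IsConnIdeal P J ∧ IntersectNontrivially I J}.Subsingleton

/-- The graph `G_P` on the connected order ideals of `P`; two of them are adjacent if they have
nonempty intersection and are incomparable under inclusion. -/
def idealGraph (P : PartialOrder (Fin n)) : SimpleGraph {J : Finset (Fin n) // IsConnIdeal P J} where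
  Adj I J := IntersectNontrivially I.1 J.1
  symm := ⟨fun I J h => ⟨Finset.inter_comm I.1 J.1 ▸ h.1, h.2.2, h.2.1⟩⟩
  loopless := ⟨fun _ h => h.2.1 subset_rfl⟩

open Classical in
/-- The set of connected order ideals of `P`. -/
noncomputable def connIdeals (P : PartialOrder (Fin n)) : Finset (Finset (Fin n)) :=
  Finset.univ.filter (IsConnIdeal P)

open Classical in
/-- `Π(P)`: the set of all (unordered) pairs `{I, J}` of connected order ideals of `P` that
intersect nontrivially. -/
noncomputable def crossingPairs (P : PartialOrder (Fin n)) : Finset (Finset (Finset (Fin n))) :=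
  Finset.univ.filter fun S => ∃ I J : Finset (Fin n),
    IsConnIdeal P I ∧ IsConnIdeal P J ∧ IntersectNontrivially I J ∧ S = {I, J}

/-- The monomial `x^J = ∏_{i ∈ J} x_i`. -/
noncomputable def xPow (J : Finset (Fin n)) : MvPowerSeries (Fin n) ℚ :=
  ∏ i ∈ J, MvPowerSeries.X i

/-- `∏_{{I, J} ∈ Π(P)} (1 - x^I x^J)`. -/
noncomputable def numer (P : PartialOrder (Fin n)) : MvPowerSeries (Fin n) ℚ :=
  ∏ S ∈ crossingPairs P, (1 - ∏ J ∈ S, xPow J)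

/-- `∏_J (1 - x^J)` over the connected order ideals `J` of `P`. -/
noncomputable def denom (P : PartialOrder (Fin n)) : MvPowerSeries (Fin n) ℚ :=
  ∏ J ∈ connIdeals P, (1 - xPow J)

end PosetGF

/-! With natural labels the `P`-partitions are exactly the order-reversing maps `f`. Such an `f` is,
in exactly one way, the sum of the indicators of a noncrossing multiset of connected ideals. For
existence, subtract the indicator of a component of the support and recurse; for uniqueness, such a
component must belong to every multiset of weight `f` (`Noncrossing.mem_of_component`). Hence `F_P`
enumerates noncrossing multisets.

In a forest with duplications, crossing is a matching on the connected ideals. An uncrossed `J`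
contributes `1/(1 - x^J)`; a crossing pair may not occur together and contributes `1/(1 - x^I) +
1/(1 - x^J) - 1 = (1 - x^I x^J)/((1 - x^I)(1 - x^J))`. A nonprincipal ideal in a crossing pair would
yield a principal ideal crossing two others. -/

/-- A finite poset has connected Hasse diagram as soon as every subset that contains a given
element and is closed under comparability is everything. -/
theorem SimpleGraph.hasse_connected_of_forall {α : Type*} [PartialOrder α] [Finite α] (x : α)
    (h : ∀ A : Set α, x ∈ A → (∀ a ∈ A, ∀ b, a ≤ b ∨ b ≤ a → b ∈ A) → ∀ b, b ∈ A) :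
    (SimpleGraph.hasse α).Connected := by
  have key : ∀ a b : α, a ≤ b → (SimpleGraph.hasse α).Reachable a b := by
    classical
    have := Fintype.ofFinite α
    have : LocallyFiniteOrder α := Fintype.toLocallyFiniteOrder
    intro a b hab
    induction le_iff_reflTransGen_covBy.1 hab with
    | refl => exact SimpleGraph.Reachable.refl _
    | tail _ hbc ih =>
      rename_i hac
      exact (ih (le_iff_reflTransGen_covBy.2 hac)).trans
        (SimpleGraph.Adj.reachable (SimpleGraph.hasse_adj.2 (Or.inl hbc)))
  have hx : ∀ b, (SimpleGraph.hasse α).Reachable x b :=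
    h {b | (SimpleGraph.hasse α).Reachable x b} (SimpleGraph.Reachable.refl _)
      fun a ha b hab => ha.trans (hab.elim (key a b) fun hba => (key b a hba).symm)
  exact (SimpleGraph.connected_iff _).2 ⟨fun a b => (hx a).symm.trans (hx b), ⟨x⟩⟩

/-! ### Graphs in which every vertex has at most one neighbour -/

theorem SimpleGraph.eq_or_adj_of_reachable {V : Type*} {G : SimpleGraph V}
    (hG : ∀ v, (G.neighborSet v).Subsingleton) {u v : V} (h : G.Reachable u v) :
    u = v ∨ G.Adj u v := by
  rw [SimpleGraph.reachable_iff_reflTransGen] at h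
  induction h with
  | refl => exact Or.inl rfl
  | tail _ hbc ih =>
    rcases ih with rfl | hab
    · exact Or.inr hbc
    · exact Or.inl (hG _ hab.symm hbc)

theorem SimpleGraph.ConnectedComponent.ncard_supp_le_two {V : Type*} {G : SimpleGraph V}
    (hG : ∀ v, (G.neighborSet v).Subsingleton) (C : G.ConnectedComponent) :
    C.supp.ncard ≤ 2 := by
  induction C using SimpleGraph.ConnectedComponent.ind with
  | _ v =>
    have hsub : (G.connectedComponentMk v).supp ⊆ insert v (G.neighborSet v) := by
      intro w hw
      rcases eq_or_adj_of_reachable hG (SimpleGraph.ConnectedComponent.exact hw) with h | h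
      · exact Or.inl h
      · exact Or.inr h.symm
    calc _ ≤ (insert v (G.neighborSet v)).ncard :=
          Set.ncard_le_ncard hsub ((hG v).finite.insert v)
      _ ≤ (G.neighborSet v).ncard + 1 := Set.ncard_insert_le _ _
      _ ≤ 2 := by
        have := (Set.ncard_le_one (hG v).finite).2 fun a ha b hb => hG v ha hb
        omega

namespace PosetGF

variable {n : ℕ} {P : PartialOrder (Fin n)} {I J K : Finset (Fin n)}

theorem IntersectNontrivially.symm (h : IntersectNontrivially I J) : IntersectNontrivially J I :=
  ⟨Finset.inter_comm I J ▸ h.1, h.2.2, h.2.1⟩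

theorem not_intersectNontrivially_self : ¬ IntersectNontrivially I I := fun h => h.2.1 subset_rfl

theorem IntersectNontrivially.ne (h : IntersectNontrivially I J) : I ≠ J := by
  rintro rfl
  exact not_intersectNontrivially_self h

/-! ### Connected order ideals -/

theorem IsConnIdeal.nonempty (h : IsConnIdeal P J) : J.Nonempty :=
  let ⟨i⟩ := h.2.nonempty
  ⟨i.1, i.2⟩

/-- The working form of connectedness: along a Hasse path in `J`, downward steps stay in `A` because
it is an ideal, so only upward steps need `hcl`. -/
theorem IsConnIdeal.subset_of_closed (hJ : IsConnIdeal P J) {A : Finset (Fin n)}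
    (hA : IsOrderIdeal P A) {i : Fin n} (hiA : i ∈ A) (hiJ : i ∈ J)
    (hcl : ∀ a ∈ A, a ∈ J → ∀ b ∈ J, P.le a b → b ∈ A) : J ⊆ A := by
  intro j hj
  have hr := hJ.2.preconnected ⟨i, hiJ⟩ ⟨j, hj⟩
  rw [SimpleGraph.reachable_iff_reflTransGen] at hr
  suffices ∀ y : {i // i ∈ J}, Relation.ReflTransGen (hasseDiagram P J).Adj ⟨i, hiJ⟩ y → y.1 ∈ A from
    this _ hr
  intro y hy
  induction hy with
  | refl => exact hiA
  | @tail b c _ hbc ih =>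
    let : Preorder {i // i ∈ J} := @Subtype.preorder (Fin n) P.toPreorder (fun i => i ∈ J)
    rcases (SimpleGraph.hasse_adj (a := b) (b := c)).1 hbc with h | h
    · exact hcl _ ih b.2 _ c.2 h.1.le
    · exact hA _ ih _ h.1.le

theorem isConnIdeal_of_forall (hJ : IsOrderIdeal P J) {i : Fin n} (hi : i ∈ J)
    (h : ∀ A : Finset (Fin n), A ⊆ J → i ∈ A →
      (∀ a ∈ A, ∀ b ∈ J, P.le a b ∨ P.le b a → b ∈ A) → J ⊆ A) : IsConnIdeal P J := by
  classical
  refine ⟨hJ, ?_⟩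
  refine @SimpleGraph.hasse_connected_of_forall {i // i ∈ J}
    (@Subtype.partialOrder (Fin n) P (fun i => i ∈ J)) _ ⟨i, hi⟩ ?_
  intro A hiA hcl b
  have hJA := h (J.filter fun j => ∃ hj : j ∈ J, (⟨j, hj⟩ : {i // i ∈ J}) ∈ A)
    (Finset.filter_subset _ _) (Finset.mem_filter.2 ⟨hi, hi, hiA⟩) (by
      intro a ha c hc hac
      obtain ⟨_, haJ, haA⟩ := Finset.mem_filter.1 ha
      exact Finset.mem_filter.2 ⟨hc, hc, hcl _ haA ⟨c, hc⟩ hac⟩)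
  exact (Finset.mem_filter.1 (hJA b.2)).2.2

/-- The connected component of an element `i` of an order ideal `S`. -/
theorem IsOrderIdeal.exists_component {S : Finset (Fin n)} (hS : IsOrderIdeal P S) {i : Fin n}
    (hi : i ∈ S) : ∃ J, IsConnIdeal P J ∧ i ∈ J ∧ J ⊆ S ∧
      ∀ a ∈ J, ∀ b ∈ S, P.le a b → b ∈ J := by
  obtain ⟨J, -, hJ⟩ := exists_minimal_le_of_wellFoundedLT
    (fun J : Finset (Fin n) => IsOrderIdeal P J ∧ i ∈ J ∧ J ⊆ S ∧
      ∀ a ∈ J, ∀ b ∈ S, P.le a b → b ∈ J) S ⟨hS, hi, subset_rfl, fun _ _ b hb _ => hb⟩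
  obtain ⟨hJi, hiJ, hJS, hJc⟩ := hJ.prop
  refine ⟨J, isConnIdeal_of_forall hJi hiJ fun A hAJ hiA hA => ?_, hiJ, hJS, hJc⟩
  -- A comparability-closed `A` inside `J` is again a candidate, so minimality gives `J ⊆ A`.
  exact hJ.le_of_le ⟨fun a ha b hb => hA a ha b (hJi a (hAJ ha) b hb) (Or.inr hb), hiA,
    hAJ.trans hJS, fun a ha b hb hab => hA a ha b (hJc a (hAJ ha) b hb hab) (Or.inl hab)⟩ hAJ

theorem exists_principal (P : PartialOrder (Fin n)) (a : Fin n) :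
    ∃ A : Finset (Fin n), (∀ j, j ∈ A ↔ P.le j a) ∧ IsConnIdeal P A := by
  classical
  have hA : ∀ j, j ∈ Finset.univ.filter (fun j => P.le j a) ↔ P.le j a := by simp
  refine ⟨Finset.univ.filter fun j => P.le j a, hA, isConnIdeal_of_forall (i := a) ?_ ?_ ?_⟩
  · intro i hi j hj
    exact (hA j).2 (P.le_trans _ _ _ hj ((hA i).1 hi))
  · exact (hA a).2 (P.le_refl a)
  · intro A _ haA hcl j hj
    exact hcl a haA j hj (Or.inr ((hA j).1 hj))

theorem IsForestWithDuplications.isPrincipalIdeal (hP : IsForestWithDuplications P)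
    (hI : IsConnIdeal P I) (hJ : IsConnIdeal P J) (hIJ : IntersectNontrivially I J) :
    IsPrincipalIdeal P I := by
  by_contra hnp
  -- If `a ∉ J`, the principal ideal `A` of `a` crosses both `J` and a principal ideal `B ⊆ I`;
  -- uniqueness forces `B = J`, although `J ⊈ I`.
  have main : ∀ a ∈ I, (∀ b ∈ I, P.le a b → b = a) → ∀ c ∈ J, P.le c a → a ∈ J := by
    intro a ha hmax c hcJ hca
    obtain ⟨A, hA, hAc⟩ := exists_principal P a
    have hAI : A ⊆ I := fun j hj => hI.1 a ha j ((hA j).1 hj)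
    have haA : a ∈ A := (hA a).2 (P.le_refl a)
    have hIA : ¬ I ⊆ A := fun h => hnp ⟨a, fun j => ⟨fun hj => (hA j).1 (h hj), fun hj =>
      hAI ((hA j).2 hj)⟩⟩
    obtain ⟨x, hxA, y, hyI, hxy, hyA⟩ : ∃ x ∈ A, ∃ y ∈ I, P.le x y ∧ y ∉ A := by
      by_contra! hcon
      exact hIA (hI.subset_of_closed hAc.1 haA ha fun x hx _ y hy hxy => hcon x hx y hy hxy)
    obtain ⟨B, hB, hBc⟩ := exists_principal P y
    have hBI : B ⊆ I := fun j hj => hI.1 y hyI j ((hB j).1 hj)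
    have hAB : IntersectNontrivially A B := by
      refine ⟨⟨x, Finset.mem_inter.2 ⟨hxA, (hB x).2 hxy⟩⟩, fun h => ?_, fun h =>
        hyA (h ((hB y).2 (P.le_refl y)))⟩
      have := hmax y hyI ((hB a).1 (h haA))
      exact hyA (this ▸ haA)
    by_contra haJ
    have hAJ : IntersectNontrivially A J :=
      ⟨⟨c, Finset.mem_inter.2 ⟨(hA c).2 hca, hcJ⟩⟩, fun h => haJ (h haA),
        fun h => hIJ.2.2 (h.trans hAI)⟩
    have : B = J := hP A hAc ⟨hBc, hAB⟩ ⟨hJ, hAJ⟩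
    exact hIJ.2.2 (this ▸ hBI)
  obtain ⟨c, hc⟩ := hIJ.1
  obtain ⟨hcI, hcJ⟩ := Finset.mem_inter.1 hc
  refine hIJ.2.1 (hI.subset_of_closed hJ.1 hcJ hcI fun d hdJ _ b hb hdb => ?_)
  obtain ⟨a, hba, ha⟩ := @Finset.exists_le_maximal (Fin n) P.toPreorder b I hb
  have haJ := main a ha.1 (fun e he hae => P.le_antisymm _ _ (ha.2 he hae) hae) d hdJ
    (P.le_trans _ _ _ hdb hba)
  exact hJ.1 a haJ b hba

/-! ### Noncrossing multisets of ideals -/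

/-- No two members of the multiset intersect nontrivially. -/
def Noncrossing (m : Multiset (Finset (Fin n))) : Prop :=
  ∀ I ∈ m, ∀ J ∈ m, ¬ IntersectNontrivially I J

/-- The indicator of `J`, i.e. the exponent of `x^J`. -/
noncomputable def indicator (J : Finset (Fin n)) : Fin n →₀ ℕ := ∑ i ∈ J, Finsupp.single i 1

/-- The sum of the indicators of the members of a multiset. -/
noncomputable def weight (m : Multiset (Finset (Fin n))) : Fin n →₀ ℕ := (m.map indicator).sum

open Classical in
theorem indicator_apply (J : Finset (Fin n)) (i : Fin n) :
    indicator J i = if i ∈ J then 1 else 0 := by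
  simp [indicator, Finsupp.finsetSum_apply, Finsupp.single_apply]

theorem weight_cons (J : Finset (Fin n)) (m : Multiset (Finset (Fin n))) :
    weight (J ::ₘ m) = indicator J + weight m := by
  simp [weight]

theorem weight_apply_pos_iff (m : Multiset (Finset (Fin n))) (i : Fin n) :
    0 < weight m i ↔ ∃ J ∈ m, i ∈ J := by
  classical
  induction m using Multiset.induction_on with
  | empty => simp [weight]
  | cons J m ih =>
    rw [weight_cons, Finsupp.add_apply, indicator_apply]
    by_cases hi : i ∈ J <;> simp [hi, ih]

theorem Noncrossing.mono {m m' : Multiset (Finset (Fin n))} (h : Noncrossing m) (hm : m' ⊆ m) :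
    Noncrossing m' := fun I hI J hJ => h I (hm hI) J (hm hJ)

theorem Noncrossing.cons {m : Multiset (Finset (Fin n))} (h : Noncrossing m)
    (hJ : ∀ I ∈ m, ¬ IntersectNontrivially I J) : Noncrossing (J ::ₘ m) := by
  intro A hA B hB
  rcases Multiset.mem_cons.1 hA with rfl | hA' <;> rcases Multiset.mem_cons.1 hB with rfl | hB'
  · exact not_intersectNontrivially_self
  · exact fun hc => hJ B hB' hc.symm
  · exact hJ A hA'
  · exact h A hA' B hB'

theorem weight_antitone {m : Multiset (Finset (Fin n))} (hm : ∀ J ∈ m, IsOrderIdeal P J)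
    {i j : Fin n} (hij : P.le i j) : weight m j ≤ weight m i := by
  classical
  induction m using Multiset.induction_on with
  | empty => simp [weight]
  | cons J m ih =>
    have hJ := hm J (Multiset.mem_cons_self J m)
    have := ih fun I hI => hm I (Multiset.mem_cons_of_mem hI)
    simp only [weight_cons, Finsupp.add_apply, indicator_apply]
    by_cases hj : j ∈ J
    · simpa [hj, hJ j hj i hij] using this
    · simp only [hj, if_false]
      omega

/-- A component of the support of `weight m` belongs to `m`. -/
theorem Noncrossing.mem_of_component {m : Multiset (Finset (Fin n))} (hm : Noncrossing m)
    (hconn : ∀ I ∈ m, IsConnIdeal P I) (hJ : IsConnIdeal P J)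
    (hsupp : ∀ i ∈ J, 0 < weight m i)
    (hcl : ∀ a ∈ J, ∀ b, 0 < weight m b → P.le a b → b ∈ J) : J ∈ m := by
  classical
  obtain ⟨i, hi⟩ := hJ.nonempty
  obtain ⟨A₀, hA₀, hiA₀⟩ := (weight_apply_pos_iff m i).1 (hsupp i hi)
  obtain ⟨A, hA₀A, hA⟩ := (m.toFinset.filter (i ∈ ·)).exists_le_maximal
    (Finset.mem_filter.2 ⟨Multiset.mem_toFinset.2 hA₀, hiA₀⟩)
  obtain ⟨hAm, hiA⟩ := Finset.mem_filter.1 hA.prop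
  rw [Multiset.mem_toFinset] at hAm
  have hAJ : A ⊆ J := (hconn A hAm).subset_of_closed hJ.1 hi hiA fun a haJ _ b hb hab =>
    hcl a haJ b ((weight_apply_pos_iff m b).2 ⟨A, hAm, hb⟩) hab
  -- A member `B` covering a point of `J` just outside `A` meets `A`, so noncrossing gives `A ⊂ B`,
  -- against maximality of `A`.
  have hJA : J ⊆ A := hJ.subset_of_closed (hconn A hAm).1 hiA hi fun a haA _ b hb hab => by
    by_contra hbA
    obtain ⟨B, hBm, hbB⟩ := (weight_apply_pos_iff m b).1 (hsupp b hb)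
    have haB : a ∈ B := (hconn B hBm).1 b hbB a hab
    have hAB : A ⊆ B := by
      by_contra hAB
      exact hm A hAm B hBm ⟨⟨a, Finset.mem_inter.2 ⟨haA, haB⟩⟩, hAB, fun h => hbA (h hbB)⟩
    exact hbA (hA.le_of_ge (Finset.mem_filter.2 ⟨Multiset.mem_toFinset.2 hBm, hAB hiA⟩) hAB hbB)
  exact (hAJ.antisymm hJA) ▸ hAm

theorem exists_component_of_ne_zero {f : Fin n →₀ ℕ} (hf : ∀ i j, P.le i j → f j ≤ f i)
    (h0 : f ≠ 0) : ∃ J, IsConnIdeal P J ∧ (∀ i ∈ J, 0 < f i) ∧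
      ∀ a ∈ J, ∀ b, 0 < f b → P.le a b → b ∈ J := by
  have hmem : ∀ i, i ∈ f.support ↔ 0 < f i := fun i => by
    rw [Finsupp.mem_support_iff, Nat.pos_iff_ne_zero]
  have hS : IsOrderIdeal P f.support := fun i hi j hji =>
    (hmem j).2 (((hmem i).1 hi).trans_le (hf j i hji))
  obtain ⟨i, hi⟩ := Finsupp.support_nonempty_iff.2 h0
  obtain ⟨J, hJ, -, hJS, hJc⟩ := hS.exists_component hi
  exact ⟨J, hJ, fun i hi => (hmem i).1 (hJS hi), fun a ha b hb => hJc a ha b ((hmem b).2 hb)⟩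

theorem weight_ne_zero {m : Multiset (Finset (Fin n))} (hconn : ∀ I ∈ m, IsConnIdeal P I)
    (hJ : J ∈ m) : weight m ≠ 0 := by
  intro h
  obtain ⟨i, hi⟩ := (hconn J hJ).nonempty
  have := (weight_apply_pos_iff m i).2 ⟨J, hJ, hi⟩
  simp [h] at this

/-- A component of the common support lies in both multisets; cancel it and induct. Thus the 0/1
coefficients of `weightSeries` count multisets of connected ideals. -/
theorem Noncrossing.eq_of_weight_eq {m m' : Multiset (Finset (Fin n))} (hm : Noncrossing m)
    (hm' : Noncrossing m') (hconn : ∀ I ∈ m, IsConnIdeal P I) (hconn' : ∀ I ∈ m', IsConnIdeal P I)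
    (h : weight m = weight m') : m = m' := by
  classical
  induction hN : m.card generalizing m m' with
  | zero =>
    obtain rfl := Multiset.card_eq_zero.1 hN
    refine (Multiset.eq_zero_of_forall_notMem fun J hJ => ?_).symm
    exact weight_ne_zero hconn' hJ (h.symm.trans (by simp [weight]))
  | succ N ih =>
    obtain ⟨A, hA⟩ := Multiset.card_pos_iff_exists_mem.1 (by omega : 0 < m.card)
    obtain ⟨J, hJ, hpos, hcl⟩ := exists_component_of_ne_zero
      (fun i j hij => weight_antitone (fun I hI => (hconn I hI).1) hij) (weight_ne_zero hconn hA)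
    have hJm := hm.mem_of_component hconn hJ hpos hcl
    have hJm' := hm'.mem_of_component hconn' hJ (h ▸ hpos) (h ▸ hcl)
    obtain ⟨k, rfl⟩ := Multiset.exists_cons_of_mem hJm
    obtain ⟨k', rfl⟩ := Multiset.exists_cons_of_mem hJm'
    rw [weight_cons, weight_cons, add_right_inj] at h
    rw [ih (hm.mono (Multiset.subset_cons _ _)) (hm'.mono (Multiset.subset_cons _ _))
      (fun I hI => hconn I (Multiset.mem_cons_of_mem hI))
      (fun I hI => hconn' I (Multiset.mem_cons_of_mem hI)) h (by simpa using hN)]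

theorem exists_noncrossing_weight_eq {f : Fin n →₀ ℕ} (hf : ∀ i j, P.le i j → f j ≤ f i) :
    ∃ m, (∀ I ∈ m, IsConnIdeal P I) ∧ Noncrossing m ∧ weight m = f := by
  classical
  induction f using WellFoundedLT.induction with
  | _ f ih =>
  by_cases h0 : f = 0
  · exact ⟨0, by simp, by simp [Noncrossing], by simp [weight, h0]⟩
  obtain ⟨J, hJ, hpos, hcl⟩ := exists_component_of_ne_zero hf h0
  have hle : indicator J ≤ f := fun i => by
    rw [indicator_apply]
    split_ifs with hi
    · exact hpos i hi
    · exact Nat.zero_le _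
  obtain ⟨g, rfl⟩ := exists_add_of_le hle
  have hval : ∀ i, (indicator J + g) i = (if i ∈ J then 1 else 0) + g i := fun i => by
    rw [Finsupp.add_apply, indicator_apply]
  have hlt : g < indicator J + g := by
    refine lt_of_le_of_ne le_add_self fun heq => ?_
    obtain ⟨i, hi⟩ := hJ.nonempty
    have := hval i
    rw [← heq, if_pos hi] at this
    omega
  have hg : ∀ i j, P.le i j → g j ≤ g i := by
    intro i j hij
    have h1 := hf i j hij
    rw [hval, hval] at h1
    by_cases hj : j ∈ J
    · rw [if_pos hj, if_pos (hJ.1 j hj i hij)] at h1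
      omega
    · rw [if_neg hj] at h1
      by_cases hi : i ∈ J
      · have : ¬ 0 < (indicator J + g) j := fun h => hj (hcl i hi j h hij)
        rw [hval] at this
        omega
      · rw [if_neg hi] at h1
        omega
  obtain ⟨m, hconn, hm, rfl⟩ := ih g hlt hg
  refine ⟨J ::ₘ m, ?_, hm.cons fun I hI hIJ => ?_, weight_cons J m⟩
  · intro I hI
    rcases Multiset.mem_cons.1 hI with rfl | hI
    · exact hJ
    · exact hconn I hI
  -- Members of `m` lie in the support of `f`, so one that meets the component `J` is contained in
  -- it.
  · obtain ⟨c, hc⟩ := hIJ.1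
    obtain ⟨hcI, hcJ⟩ := Finset.mem_inter.1 hc
    refine hIJ.2.1 ((hconn I hI).subset_of_closed hJ.1 hcJ hcI fun a haJ _ b hb hab =>
      hcl a haJ b ?_ hab)
    have := (weight_apply_pos_iff m b).2 ⟨I, hI, hb⟩
    rw [hval]
    omega

/-! ### Generating functions of noncrossing multisets -/

/-- `f` is the weight of a noncrossing multiset with members in `K`. -/
def IsWeightOf (K : Finset (Finset (Fin n))) (f : Fin n →₀ ℕ) : Prop :=
  ∃ m : Multiset (Finset (Fin n)), (∀ I ∈ m, I ∈ K) ∧ Noncrossing m ∧ weight m = f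

open Classical in
/-- The sum of `x^f` over the weights `f` of noncrossing multisets with members in `K`. -/
noncomputable def weightSeries (K : Finset (Finset (Fin n))) : MvPowerSeries (Fin n) ℚ :=
  fun f => if IsWeightOf K f then 1 else 0

open Classical in
theorem coeff_weightSeries (K : Finset (Finset (Fin n))) (f : Fin n →₀ ℕ) :
    MvPowerSeries.coeff f (weightSeries K) = if IsWeightOf K f then 1 else 0 := rfl

theorem xPow_eq_monomial (J : Finset (Fin n)) :
    xPow J = MvPowerSeries.monomial (indicator J) (1 : ℚ) := by
  classical
  unfold xPow indicator
  induction J using Finset.induction_on with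
  | empty => simp [MvPowerSeries.monomial_zero_one]
  | insert i J hi ih =>
    rw [Finset.prod_insert hi, Finset.sum_insert hi, ih, MvPowerSeries.X,
      MvPowerSeries.monomial_mul_monomial, one_mul]

theorem genFun_eq_weightSeries (hnat : NaturallyLabeled P) :
    genFun P = weightSeries (connIdeals P) := by
  classical
  have hmem : ∀ I, I ∈ connIdeals P ↔ IsConnIdeal P I := by simp [connIdeals]
  funext f
  refine if_congr ⟨fun hf => ?_, ?_⟩ rfl rfl
  · obtain ⟨m, hm⟩ := exists_noncrossing_weight_eq (P := P) (f := f) fun i j hij => by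
      rcases (@le_iff_lt_or_eq _ P i j).1 hij with h | rfl
      · exact hf.1 i j h
      · exact le_rfl
    exact ⟨m, fun I hI => (hmem I).2 (hm.1 I hI), hm.2⟩
  · rintro ⟨m, hmK, -, rfl⟩
    exact ⟨fun i j hij => weight_antitone (fun I hI => ((hmem I).1 (hmK I hI)).1)
      ((@le_iff_lt_or_eq _ P i j).2 (Or.inl hij)), fun i j hij hji =>
      absurd (hnat i j hij) (Fin.lt_asymm hji)⟩

theorem weightSeries_empty : weightSeries (∅ : Finset (Finset (Fin n))) = 1 := by
  classical
  ext f
  rw [coeff_weightSeries, MvPowerSeries.coeff_one]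
  refine if_congr ⟨?_, ?_⟩ rfl rfl
  · rintro ⟨m, hm, -, rfl⟩
    rw [Multiset.eq_zero_of_forall_notMem fun I hI => absurd (hm I hI) (Finset.notMem_empty I)]
    simp [weight]
  · rintro rfl
    exact ⟨0, by simp, by simp [Noncrossing], by simp [weight]⟩

-- `J` may be added freely to any noncrossing multiset over `insert J K`, so multiplying by `1 -
-- x^J` cancels exactly those containing `J`.
open Classical in
theorem weightSeries_insert_mul {K : Finset (Finset (Fin n))}
    (hK : ∀ I ∈ insert J K, IsConnIdeal P I) (hJK : J ∉ K)
    (hcr : ∀ I ∈ K, ¬ IntersectNontrivially I J) :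
    weightSeries (insert J K) * (1 - xPow J) = weightSeries K := by
  have hins : ∀ m : Multiset (Finset (Fin n)), (∀ I ∈ m, I ∈ insert J K) → Noncrossing m →
      (∀ I ∈ J ::ₘ m, I ∈ insert J K) ∧ Noncrossing (J ::ₘ m) := by
    intro m hmK hm
    refine ⟨fun I hI => ?_, hm.cons fun I hI => ?_⟩
    · rcases Multiset.mem_cons.1 hI with rfl | hI
      · exact Finset.mem_insert_self _ _
      · exact hmK I hI
    · rcases Finset.mem_insert.1 (hmK I hI) with rfl | hI
      · exact not_intersectNontrivially_self
      · exact hcr I hI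
  ext f
  rw [mul_sub, mul_one, mul_comm, map_sub, xPow_eq_monomial, MvPowerSeries.coeff_monomial_mul,
    one_mul]
  simp only [coeff_weightSeries]
  by_cases h1 : IsWeightOf K f
  · have h2 : IsWeightOf (insert J K) f :=
      let ⟨m, hm⟩ := h1
      ⟨m, fun I hI => Finset.mem_insert_of_mem (hm.1 I hI), hm.2⟩
    have h3 : ¬ (indicator J ≤ f ∧ IsWeightOf (insert J K) (f - indicator J)) := by
      rintro ⟨hle, m', hmK', hm', hw'⟩
      obtain ⟨m, hmK, hm, hw⟩ := h1
      obtain ⟨hmJ, hmJ'⟩ := hins m' hmK' hm'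
      have heq : J ::ₘ m' = m := hmJ'.eq_of_weight_eq hm (fun I hI => hK I (hmJ I hI))
        (fun I hI => hK I (Finset.mem_insert_of_mem (hmK I hI)))
        (by rw [weight_cons, hw', hw, add_tsub_cancel_of_le hle])
      exact hJK (hmK J (heq ▸ Multiset.mem_cons_self J m'))
    rw [if_pos h1, if_pos h2, ← ite_and, if_neg h3, sub_zero]
  · have h3 : IsWeightOf (insert J K) f ↔
        indicator J ≤ f ∧ IsWeightOf (insert J K) (f - indicator J) := by
      constructor
      · rintro ⟨m, hmK, hm, rfl⟩
        have hJm : J ∈ m := by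
          by_contra hJm
          refine h1 ⟨m, fun I hI => ?_, hm, rfl⟩
          rcases Finset.mem_insert.1 (hmK I hI) with rfl | h
          · exact absurd hI hJm
          · exact h
        obtain ⟨k, rfl⟩ := Multiset.exists_cons_of_mem hJm
        rw [weight_cons, add_tsub_cancel_left]
        exact ⟨le_self_add, k, fun I hI => hmK I (Multiset.mem_cons_of_mem hI),
          hm.mono (Multiset.subset_cons _ _), rfl⟩
      · rintro ⟨hle, m, hmK, hm, hw⟩
        obtain ⟨hmJ, hmJ'⟩ := hins m hmK hm
        exact ⟨J ::ₘ m, hmJ, hmJ', by rw [weight_cons, hw, add_tsub_cancel_of_le hle]⟩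
    rw [if_neg h1, ← ite_and, if_congr h3 rfl rfl, sub_self]

-- Inclusion–exclusion: a noncrossing multiset omits `I` or `J`, and by uniqueness a weight attained
-- both ways comes from one omitting both.
open Classical in
theorem weightSeries_insert_insert {K : Finset (Finset (Fin n))}
    (hK : ∀ A ∈ insert I (insert J K), IsConnIdeal P A) (hI : I ∉ K)
    (hIJ : IntersectNontrivially I J) :
    weightSeries (insert I (insert J K)) =
      weightSeries (insert I K) + weightSeries (insert J K) - weightSeries K := by
  have hmono : ∀ {K₁ K₂ : Finset (Finset (Fin n))} {f}, K₁ ⊆ K₂ → IsWeightOf K₁ f →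
      IsWeightOf K₂ f := fun h ⟨m, hm⟩ => ⟨m, fun A hA => h (hm.1 A hA), hm.2⟩
  have hsub : insert I K ⊆ insert I (insert J K) :=
    Finset.insert_subset_insert _ (Finset.subset_insert _ _)
  ext f
  have hor : IsWeightOf (insert I (insert J K)) f ↔
      IsWeightOf (insert I K) f ∨ IsWeightOf (insert J K) f := by
    refine ⟨?_, fun h => h.elim (hmono hsub) (hmono (Finset.subset_insert _ _))⟩
    rintro ⟨m, hmK, hm, rfl⟩
    by_cases hIm : I ∈ m
    · refine Or.inl ⟨m, fun A hA => ?_, hm, rfl⟩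
      have := hmK A hA
      have hAJ : A ≠ J := fun h => hm I hIm A hA (h ▸ hIJ)
      simp only [Finset.mem_insert] at this ⊢
      tauto
    · refine Or.inr ⟨m, fun A hA => ?_, hm, rfl⟩
      exact (Finset.mem_insert.1 (hmK A hA)).resolve_left fun h => hIm (h ▸ hA)
  have hand : IsWeightOf K f ↔ IsWeightOf (insert I K) f ∧ IsWeightOf (insert J K) f := by
    refine ⟨fun h => ⟨hmono (Finset.subset_insert _ _) h, hmono (Finset.subset_insert _ _) h⟩, ?_⟩
    rintro ⟨⟨m, hmK, hm, rfl⟩, m', hmK', hm', hw⟩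
    have heq : m' = m := hm'.eq_of_weight_eq hm
      (fun A hA => hK A (Finset.mem_insert_of_mem (hmK' A hA)))
      (fun A hA => hK A (hsub (hmK A hA))) hw
    subst heq
    refine ⟨m', fun A hA => ?_, hm, rfl⟩
    have h1 := hmK A hA
    have h2 := hmK' A hA
    have := hIJ.ne
    rw [Finset.mem_insert] at h1 h2
    rcases h1 with rfl | h1
    · exact h2.resolve_left this
    · exact h1
  simp only [map_sub, map_add, coeff_weightSeries, hor, hand]
  by_cases h1 : IsWeightOf (insert I K) f <;> by_cases h2 : IsWeightOf (insert J K) f <;>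
    simp [h1, h2]

open Classical in
/-- The pairs of members of `K` that intersect nontrivially. -/
noncomputable def pairsIn (K : Finset (Finset (Fin n))) : Finset (Finset (Finset (Fin n))) :=
  Finset.univ.filter fun S => ∃ I ∈ K, ∃ J ∈ K, IntersectNontrivially I J ∧ S = {I, J}

open Classical in
theorem mem_pairsIn {K : Finset (Finset (Fin n))} {S : Finset (Finset (Fin n))} :
    S ∈ pairsIn K ↔ ∃ I ∈ K, ∃ J ∈ K, IntersectNontrivially I J ∧ S = {I, J} := by
  simp [pairsIn]

open Classical in
theorem pairsIn_insert {K : Finset (Finset (Fin n))}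
    (hcr : ∀ I ∈ K, ¬ IntersectNontrivially I J) : pairsIn (insert J K) = pairsIn K := by
  ext S
  simp only [mem_pairsIn]
  constructor
  · rintro ⟨A, hA, B, hB, hAB, rfl⟩
    rcases Finset.mem_insert.1 hA with rfl | hA' <;> rcases Finset.mem_insert.1 hB with rfl | hB'
    · exact absurd hAB not_intersectNontrivially_self
    · exact absurd hAB.symm (hcr B hB')
    · exact absurd hAB (hcr A hA')
    · exact ⟨A, hA', B, hB', hAB, rfl⟩
  · rintro ⟨A, hA, B, hB, h⟩
    exact ⟨A, Finset.mem_insert_of_mem hA, B, Finset.mem_insert_of_mem hB, h⟩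

open Classical in
theorem pairsIn_insert_insert {K : Finset (Finset (Fin n))} (hIJ : IntersectNontrivially I J)
    (hI : ∀ A ∈ K, ¬ IntersectNontrivially A I) (hJ : ∀ A ∈ K, ¬ IntersectNontrivially A J) :
    pairsIn (insert I (insert J K)) = insert {I, J} (pairsIn K) := by
  ext S
  rw [Finset.mem_insert, ← pairsIn_insert hJ]
  simp only [mem_pairsIn]
  constructor
  · rintro ⟨A, hA, B, hB, hAB, rfl⟩
    have key : ∀ C ∈ insert J K, IntersectNontrivially I C → C = J := fun C hC hIC =>
      (Finset.mem_insert.1 hC).resolve_right fun h => hI C h hIC.symm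
    rcases Finset.mem_insert.1 hA with rfl | hA' <;> rcases Finset.mem_insert.1 hB with rfl | hB'
    · exact absurd hAB not_intersectNontrivially_self
    · exact Or.inl (by rw [key B hB' hAB])
    · exact Or.inl (by rw [key A hA' hAB.symm, Finset.pair_comm])
    · exact Or.inr ⟨A, hA', B, hB', hAB, rfl⟩
  · rintro (rfl | ⟨A, hA, B, hB, h⟩)
    · exact ⟨I, by simp, J, by simp, hIJ, rfl⟩
    · exact ⟨A, Finset.mem_insert_of_mem hA, B, Finset.mem_insert_of_mem hB, h⟩

/-! ### The product formula -/

theorem IsForestWithDuplications.weightSeries_mul (hP : IsForestWithDuplications P)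
    (K : Finset (Finset (Fin n))) (hK : ∀ I ∈ K, IsConnIdeal P I) :
    weightSeries K * ∏ J ∈ K, (1 - xPow J) = ∏ S ∈ pairsIn K, (1 - ∏ J ∈ S, xPow J) := by
  classical
  induction K using Finset.strongInduction with
  | H K ih =>
  rcases K.eq_empty_or_nonempty with rfl | ⟨J, hJ⟩
  · have : pairsIn (∅ : Finset (Finset (Fin n))) = ∅ := by
      ext S
      simp [mem_pairsIn]
    simp [this, weightSeries_empty]
  obtain ⟨K, hJK, rfl⟩ : ∃ L, J ∉ L ∧ K = insert J L :=
    ⟨K.erase J, Finset.notMem_erase _ _, (Finset.insert_erase hJ).symm⟩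
  by_cases hcr : ∀ I ∈ K, ¬ IntersectNontrivially I J
  · rw [Finset.prod_insert hJK, ← mul_assoc, weightSeries_insert_mul hK hJK hcr,
      pairsIn_insert hcr]
    exact ih K (Finset.ssubset_insert hJK) fun I hI => hK I (Finset.mem_insert_of_mem hI)
  push Not at hcr
  obtain ⟨I, hI, hIJ⟩ := hcr
  obtain ⟨K, hIK, rfl⟩ : ∃ L, I ∉ L ∧ K = insert I L :=
    ⟨K.erase I, Finset.notMem_erase _ _, (Finset.insert_erase hI).symm⟩
  have hJK' : J ∉ K := fun h => hJK (Finset.mem_insert_of_mem h)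
  have hJc := hK J (by simp)
  have hIc := hK I (by simp)
  have hKc : ∀ A ∈ K, IsConnIdeal P A := fun A hA => hK A (by simp [hA])
  have hcI : ∀ A ∈ K, ¬ IntersectNontrivially A I := fun A hA h =>
    hJK' (hP I hIc ⟨hKc A hA, h.symm⟩ ⟨hJc, hIJ⟩ ▸ hA)
  have hcJ : ∀ A ∈ K, ¬ IntersectNontrivially A J := fun A hA h =>
    hIK (hP J hJc ⟨hKc A hA, h.symm⟩ ⟨hIc, hIJ.symm⟩ ▸ hA)
  have hpair : ({J, I} : Finset (Finset (Fin n))) ∉ pairsIn K := by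
    rw [mem_pairsIn]
    rintro ⟨A, hA, B, hB, -, h⟩
    have : J ∈ ({A, B} : Finset (Finset (Fin n))) := h ▸ Finset.mem_insert_self _ _
    rcases Finset.mem_insert.1 this with rfl | h'
    · exact hJK' hA
    · exact hJK' (Finset.mem_singleton.1 h' ▸ hB)
  have e1 := weightSeries_insert_mul (P := P) (J := I) (K := K)
    (fun A hA => hK A (Finset.mem_insert_of_mem hA)) hIK hcI
  have e2 := weightSeries_insert_mul (P := P) (J := J) (K := K)
    (fun A hA => hK A (Finset.insert_subset_insert _ (Finset.subset_insert _ _) hA)) hJK' hcJ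
  have e3 := ih K ((Finset.ssubset_insert hIK).trans (Finset.ssubset_insert hJK)) hKc
  rw [Finset.prod_insert hJK, Finset.prod_insert hIK,
    pairsIn_insert_insert hIJ.symm hcJ hcI, Finset.prod_insert hpair,
    Finset.prod_pair hIJ.ne.symm, weightSeries_insert_insert hK hJK' hIJ.symm, ← e3]
  -- Behind this is `(1 - x^I) + (1 - x^J) - (1 - x^I)(1 - x^J) = 1 - x^I x^J`.
  linear_combination (1 - xPow I) * (∏ A ∈ K, (1 - xPow A)) * e2 +
    (1 - xPow J) * (∏ A ∈ K, (1 - xPow A)) * e1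

theorem crossingPairs_eq_pairsIn (P : PartialOrder (Fin n)) :
    crossingPairs P = pairsIn (connIdeals P) := by
  classical
  ext S
  simp only [crossingPairs, mem_pairsIn, connIdeals, Finset.mem_filter, Finset.mem_univ, true_and]
  constructor
  · rintro ⟨I, J, hI, hJ, h⟩
    exact ⟨I, hI, J, hJ, h⟩
  · rintro ⟨I, hI, J, hJ, h⟩
    exact ⟨I, J, hI, hJ, h⟩

theorem constantCoeff_denom (P : PartialOrder (Fin n)) :
    MvPowerSeries.constantCoeff (denom P) = 1 := by
  classical
  rw [denom, map_prod]
  refine Finset.prod_eq_one fun J hJ => ?_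
  obtain ⟨i, hi⟩ := (Finset.mem_filter.1 hJ).2.nonempty
  rw [map_sub, map_one, xPow, map_prod,
    Finset.prod_eq_zero hi (MvPowerSeries.constantCoeff_X i), sub_zero]

theorem IsForestWithDuplications.subsingleton_neighborSet (hP : IsForestWithDuplications P)
    (I : {J : Finset (Fin n) // IsConnIdeal P J}) :
    ((idealGraph P).neighborSet I).Subsingleton :=
  fun A hA B hB => Subtype.ext (hP I.1 I.2 ⟨A.2, hA⟩ ⟨B.2, hB⟩)

end PosetGF

/-- The `IsUnit` conjunct excludes the default value `0` of `⁻¹`, so the quotient is genuine. -/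
theorem mainTheorem4 (n : ℕ) (P : PartialOrder (Fin n))
    (hnat : PosetGF.NaturallyLabeled P) (hdup : PosetGF.IsForestWithDuplications P) :
    (IsUnit (PosetGF.denom P) ∧
      PosetGF.genFun P = PosetGF.numer P * (PosetGF.denom P)⁻¹) ∧
    (∀ C : (PosetGF.idealGraph P).ConnectedComponent,
      C.supp.ncard ≤ 2 ∧
      (C.supp.ncard = 2 → ∀ J ∈ C.supp, PosetGF.IsPrincipalIdeal P J.1)) := by
  have hc := PosetGF.constantCoeff_denom P
  have hG := hdup.subsingleton_neighborSet
  refine ⟨⟨?_, ?_⟩, fun C => ⟨C.ncard_supp_le_two hG, fun h2 J hJ => ?_⟩⟩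
  · rw [MvPowerSeries.isUnit_iff_constantCoeff, hc]
    exact isUnit_one
  · rw [MvPowerSeries.eq_mul_inv_iff_mul_eq (by rw [hc]; exact one_ne_zero),
      PosetGF.genFun_eq_weightSeries hnat, PosetGF.numer, PosetGF.crossingPairs_eq_pairsIn,
      PosetGF.denom]
    refine hdup.weightSeries_mul _ fun I hI => ?_
    simpa [PosetGF.connIdeals] using hI
  · obtain ⟨I, hI, hIJ⟩ := Set.exists_ne_of_one_lt_ncard (s := C.supp) (by omega) J
    have hr := SimpleGraph.ConnectedComponent.exact (hJ.trans hI.symm)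
    have hadj := (SimpleGraph.eq_or_adj_of_reachable hG hr).resolve_left hIJ.symm
    exact hdup.isPrincipalIdeal J.2 I.2 hadj
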